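/- Let $G=\langle A,B\rangle$ be a free group with free basis $A,B$. An element $W\in G$ is \emph{primitive} if some $V\in G$ generates $G$ together with $W$; then $W,V$ is called a \emph{pair of primitive associates}. Let $\widehat{\mathbb Q}=\mathbb Q\cup\{1/0\}$, with every rational written in lowest terms $p/q$, $q>0$. Two elements $p/q,\,r/s$ of $\widehat{\mathbb Q}$ are (Farey) \emph{neighbors} if $|ps-qr|=1$. For a rational $p/q\neq 0$, its \emph{distinguished neighbors} are its smallest neighbor $m/n$ and its largest neighbor $r/s$, where the point at infinity is regarded as $1/0=+\infty$ if $p/q>0$ and as $-1/0=-\infty$ if $p/q<0$. (1) Every rational $p/q\ne 0$ has distinguished neighbors $m/n$ and $r/s$, and these satisfy $\frac mn<\frac pq<\frac rs$ and $p=m+r$, $q=n+s$ (that is, $\frac pq=\frac mn\oplus\frac rs$). (2) There is exactly one family of words $(W_{p/q})_{p/q\in\widehat{\mathbb Q}}$ in $G$ with $$W_{0/1}=A,\qquad W_{1/0}=B,\qquad W_{p/q}=W_{r/s}\cdot W_{m/n}$$ for every rational $p/q\neq 0$ with distinguished neighbors $\frac mn<\frac pq<\frac rs$, where $W_{-1/0}$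 stands for $W_{1/0}^{-1}=B^{-1}$. (3) This family enumerates the primitive words of $G$: every $W_{p/q}$ is primitive, and every primitive element of $G$ is conjugate to $W_{p/q}$ or to $W_{p/q}^{-1}$ for exactly one $p/q\in\widehat{\mathbb Q}$. (4) For all $p/q,\,r/s\in\widehat{\mathbb Q}$, the words $W_{p/q},W_{r/s}$ are a pair of primitive associates if and only if $|ps-qr|=1$. -/

import Mathlib

/-- `W` and `V` form a pair of primitive associates of `G`: together they generate `G`.
(The condition is symmetric, so this is a property of the unordered pair.) -/
def ArePrimitiveAssociates {G : Type*} [Group G] (W V : G) : Prop :=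
  Subgroup.closure {W, V} = ⊤

/-- `W` is primitive: some `V` generates `G` together with `W`. -/
def IsPrimitiveWord {G : Type*} [Group G] (W : G) : Prop :=
  ∃ V : G, ArePrimitiveAssociates W V

/-- Reduced fractions `p/q` with `q > 0`, together with the point at infinity `1/0`. -/
abbrev FareyFraction : Type := OnePoint ℚ

namespace FareyFraction

/-- The numerator `p` of the reduced fraction `p/q`; it is `1` for `1/0`. -/
def num (x : FareyFraction) : ℤ := x.elim 1 (fun t => t.num)

/-- The denominator `q ≥ 0` of the reduced fraction `p/q`; it is `0` for `1/0`. -/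
def den (x : FareyFraction) : ℤ := x.elim 0 (fun t => (t.den : ℤ))

/-- `p/q` and `r/s` are Farey neighbors: `|ps - qr| = 1`. -/
def AreNeighbors (x y : FareyFraction) : Prop :=
  |num x * den y - den x * num y| = 1

/-- The place of `y` on the extended line `[-∞, ∞]`, as seen from the rational number `x`. The point
at infinity is `1/0 = +∞` if `x ≥ 0`, and it is `-1/0 = -∞` if `x < 0`. -/
def position (x : ℚ) (y : FareyFraction) : WithBot (WithTop ℚ) :=
  y.elim (if x < 0 then ⊥ else ⊤) (fun t => ((t : WithTop ℚ) : WithBot (WithTop ℚ)))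

/-- The numerator of `y` as seen from `x`: infinity is written `1/0` if `x ≥ 0`, `-1/0` if
`x < 0`. -/
def signedNum (x : ℚ) (y : FareyFraction) : ℤ :=
  y.elim (if x < 0 then -1 else 1) (fun t => t.num)

/-- `m` and `r` are the smallest and the largest neighbor of the rational number `x`. -/
def AreDistinguishedNeighbors (x : ℚ) (m r : FareyFraction) : Prop :=
  AreNeighbors x m ∧ AreNeighbors x r ∧
    ∀ y : FareyFraction, AreNeighbors x y →
      position x m ≤ position x y ∧ position x y ≤ position x r

/-- The word attached to `y` as seen from `x`, for a family `W` of words: it is `W y`, except that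
infinity, seen from `x < 0`, is `-1/0` and carries the inverse of the word at `1/0`. -/
def signedWord {G : Type*} [Group G] (W : FareyFraction → G) (x : ℚ) (y : FareyFraction) : G :=
  y.elim (if x < 0 then (W OnePoint.infty)⁻¹ else W OnePoint.infty) (fun t => W t)

/-- The family `W` of words obeys the recursion along the Farey fractions:
`W_{0/1} = A`, `W_{1/0} = B`, and `W_{p/q} = W_{r/s} * W_{m/n}` whenever `p/q ≠ 0/1, 1/0` has the
distinguished neighbors `m/n < p/q < r/s`. -/
structure IsFareyEnumeration {G : Type*} [Group G] (A B : G) (W : FareyFraction → G) : Prop where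
  zero : W ((0 : ℚ) : FareyFraction) = A
  infty : W OnePoint.infty = B
  mul : ∀ (x : ℚ) (m r : FareyFraction), x ≠ 0 → AreDistinguishedNeighbors x m r →
    W x = signedWord W x r * signedWord W x m

end FareyFraction

/-! Fractions are read as integer vectors `(p, q)`, opposite vectors carrying inverse words
(`vectorWord`). The heart is `IsFareyEnumeration.vectorWord_add`: for every unimodular pair v, w,
not only for Farey parents, the word of v + w is the product of the words of v and w in one of the
two orders. Euclidean moves on vectors thus become Nielsen moves on words, the order being absorbed
by a conjugation.

Euclid's algorithm reduces any unimodular pair to the standard one, so neighbors give generating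
pairs. Conversely, the pairs simultaneously conjugate to the words of a unimodular pair form a
Nielsen-stable class; by Nielsen's theorem it contains every generating pair. Passing to ℤ², where
the word at p/q becomes (p, q), shows that p/q is determined and that associates have determinant
±1.

Nielsen's theorem is proved by cancellation: in a pair of least total length no factor of a reduced
product is wholly cancelled, so the free generators, having length one, are members of the pair up
to inversion. -/

/-! ### Common prefixes and cancellation in free groups -/

/-- The length of the longest common prefix of two lists. -/
def commonPrefixLength {β : Type*} [DecidableEq β] : List β → List β → ℕ
  | a :: l, b :: m => if a = b then commonPrefixLength l m + 1 else 0
  | [], _ => 0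
  | _ :: _, [] => 0

section CommonPrefix

variable {β : Type*} [DecidableEq β]

theorem commonPrefixLength_comm (l m : List β) :
    commonPrefixLength l m = commonPrefixLength m l := by
  induction l generalizing m with
  | nil => cases m <;> simp [commonPrefixLength]
  | cons a l ih =>
    cases m with
    | nil => simp [commonPrefixLength]
    | cons b m => simp [commonPrefixLength, ih m, eq_comm]

theorem commonPrefixLength_ultra (l m n : List β) :
    min (commonPrefixLength l m) (commonPrefixLength m n) ≤ commonPrefixLength l n := by
  induction l generalizing m n with
  | nil => cases m <;> cases n <;> simp [commonPrefixLength]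
  | cons a l ih =>
    cases m with
    | nil => simp [commonPrefixLength]
    | cons b m =>
      cases n with
      | nil => simp [commonPrefixLength]
      | cons c n =>
        have := ih m n
        simp only [commonPrefixLength]
        split_ifs <;> grind

theorem commonPrefixLength_take (k : ℕ) (l : List β) (hk : k ≤ l.length) :
    commonPrefixLength (l.take k) l = k := by
  induction l generalizing k with
  | nil => simp_all [commonPrefixLength]
  | cons a l ih =>
    cases k with
    | zero => simp [commonPrefixLength]
    | succ k => simp [commonPrefixLength, ih k (by simpa using hk)]

theorem exists_commonPrefix (l m : List β) : ∃ p l' m', l = p ++ l' ∧ m = p ++ m' ∧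
    p.length = commonPrefixLength l m ∧ ∀ a ∈ l'.head?, ∀ b ∈ m'.head?, a ≠ b := by
  induction l generalizing m with
  | nil => exact ⟨[], [], m, by cases m <;> simp [commonPrefixLength]⟩
  | cons a l ih =>
    cases m with
    | nil => exact ⟨[], a :: l, [], by simp [commonPrefixLength]⟩
    | cons b m =>
      by_cases h : a = b
      · subst h
        obtain ⟨p, l', m', h1, h2, h3, h4⟩ := ih m
        exact ⟨a :: p, l', m', by simp [h1], by simp [h2], by simp [commonPrefixLength, h3], h4⟩
      · exact ⟨[], a :: l, b :: m, by simp [commonPrefixLength, h]⟩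

end CommonPrefix

namespace FreeGroup

variable {α : Type*} [DecidableEq α]

/-- The Gromov product of `x` and `y` based at `1`: the length of the common prefix of their reduced
words. -/
def gromov (x y : FreeGroup α) : ℕ := commonPrefixLength x.toWord y.toWord

theorem gromov_comm (x y : FreeGroup α) : gromov x y = gromov y x :=
  commonPrefixLength_comm _ _

theorem gromov_ultra (x y z : FreeGroup α) : min (gromov x y) (gromov y z) ≤ gromov x z :=
  commonPrefixLength_ultra _ _ _

theorem isReduced_invRev {L : List (α × Bool)} (h : IsReduced L) : IsReduced (invRev L) := by
  rw [isReduced_iff_reduce_eq] at *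
  rw [reduce_invRev, h]

/-- Exactly the common prefix cancels. This turns the later cancellation estimates into linear
arithmetic. -/
theorem norm_inv_mul (x y : FreeGroup α) :
    norm (x⁻¹ * y) + 2 * gromov x y = norm x + norm y := by
  obtain ⟨p, l, m, hx, hy, hp, hne⟩ := exists_commonPrefix x.toWord y.toWord
  have hl : IsReduced l := (hx ▸ isReduced_toWord (x := x)).infix (List.suffix_append p l).isInfix
  have hm : IsReduced m := (hy ▸ isReduced_toWord (x := y)).infix (List.suffix_append p m).isInfix
  have hxy : x⁻¹ * y = mk (invRev l ++ m) := by
    rw [← mk_toWord (x := x), ← mk_toWord (x := y), hx, hy, ← mul_mk, ← mul_mk, ← mul_mk, ← inv_mk]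
    group
  have hred : IsReduced (invRev l ++ m) := by
    refine List.IsChain.append (isReduced_invRev hl) hm ?_
    intro a ha b hb hab
    have : (a.1, !a.2) ∈ l.head? := by
      cases l with
      | nil => simp at ha
      | cons c l =>
        simp [invRev] at ha ⊢
        subst ha
        simp
    have := hne _ this b hb
    by_contra h
    apply this
    ext
    · exact hab
    · simp; grind
  have h1 : norm (x⁻¹ * y) = l.length + m.length := by
    rw [hxy, norm, toWord_mk, hred.reduce_eq]
    simp
  have h2 : norm x = p.length + l.length := by rw [norm, hx]; simp
  have h3 : norm y = p.length + m.length := by rw [norm, hy]; simp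
  have h4 : p.length = gromov x y := hp
  omega

theorem exists_prefix (x : FreeGroup α) (k : ℕ) (hk : k ≤ norm x) :
    ∃ q : FreeGroup α, norm q = k ∧ gromov q x = k := by
  have hred : IsReduced (x.toWord.take k) :=
    isReduced_toWord.infix (List.take_prefix k _).isInfix
  have hw : (mk (x.toWord.take k)).toWord = x.toWord.take k := by
    rw [toWord_mk, hred.reduce_eq]
  refine ⟨mk (x.toWord.take k), ?_, ?_⟩
  · rw [norm, hw, List.length_take]
    exact min_eq_left hk
  · rw [gromov, hw]
    exact commonPrefixLength_take k _ hk

/-- Write x = c k c⁻¹ with k cyclically reduced and nonempty; then c k k c⁻¹ is reduced and longer.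
-/
theorem norm_lt_norm_mul_self {x : FreeGroup α} (hx : x ≠ 1) : norm x < norm (x * x) := by
  have h1 := reduceCyclically.conj_conjugator_reduceCyclically x.toWord
  have h2 := reduceCyclically.reduce_flatten_replicate_succ (isReduced_toWord (x := x)) 1
  have h3 : norm (x * x) = (reduce (List.replicate 2 x.toWord).flatten).length := by
    rw [norm, toWord_mul]; simp [List.replicate]
  rw [h3, h2]
  have h4 : norm x = x.toWord.length := rfl
  rw [h4]
  have h5 : reduceCyclically x.toWord ≠ [] := by
    intro h
    rw [h] at h1
    apply hx
    rw [← mk_toWord (x := x), ← h1, List.append_nil, ← mul_mk, ← inv_mk, mul_inv_cancel]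
  have h6 := List.length_pos_iff.2 h5
  have h7 := congrArg List.length h1
  simp at h7 ⊢
  omega

theorem two_mul_gromov_inv_self_lt {x : FreeGroup α} (hx : x ≠ 1) :
    2 * gromov x⁻¹ x < norm x := by
  have h1 := norm_inv_mul x⁻¹ x
  have h2 := norm_lt_norm_mul_self hx
  rw [inv_inv, norm_inv_eq] at h1
  omega

/-- Since `q` is a prefix of both `g` and `g⁻¹`, and the two occurrences do not overlap, g = q h q⁻¹
without cancellation. -/
theorem norm_conj_of_le_gromov {q g : FreeGroup α} (h1 : norm q ≤ gromov q g)
    (h2 : norm q ≤ gromov q g⁻¹) (h3 : 2 * norm q ≤ norm g) :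
    norm (q⁻¹ * g * q) + 2 * norm q ≤ norm g := by
  have e1 := norm_inv_mul q g
  have e3 := norm_inv_mul (g⁻¹ * q) q
  have e4 := norm_inv_mul (g⁻¹ * q) g⁻¹
  have e5 := gromov_ultra (g⁻¹ * q) g⁻¹ q
  have e6 := gromov_comm q g⁻¹
  have n1 : norm (g⁻¹ * q) = norm (q⁻¹ * g) := by
    rw [← norm_inv_eq, mul_inv_rev, inv_inv]
  have n2 : (g⁻¹ * q)⁻¹ * q = q⁻¹ * g * q := by group
  have n3 : (g⁻¹ * q)⁻¹ * g⁻¹ = q⁻¹ := by group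
  rw [n2, n1] at e3
  rw [n3, n1, norm_inv_eq, norm_inv_eq] at e4
  omega

end FreeGroup

/-! ### Nielsen moves -/

/-- A relation on a group that is stable under the elementary Nielsen moves and under simultaneous
conjugation. -/
structure IsNielsenStable {G : Type*} [Group G] (P : G → G → Prop) : Prop where
  swap : ∀ u v, P u v → P v u
  inv : ∀ u v, P u v → P u⁻¹ v
  mul : ∀ u v, P u v → P (u * v) v
  conj : ∀ g u v, P u v → P (g⁻¹ * u * g) (g⁻¹ * v * g)

/-- `NielsenEquiv u v u' v'` holds if the pair `(u', v')` arises from `(u, v)` by elementary Nielsen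
moves and simultaneous conjugations. -/
inductive NielsenEquiv {G : Type*} [Group G] (u v : G) : G → G → Prop
  | refl : NielsenEquiv u v u v
  | swap (x y : G) : NielsenEquiv u v x y → NielsenEquiv u v y x
  | inv (x y : G) : NielsenEquiv u v x y → NielsenEquiv u v x⁻¹ y
  | mul (x y : G) : NielsenEquiv u v x y → NielsenEquiv u v (x * y) y
  | conj (g x y : G) : NielsenEquiv u v x y → NielsenEquiv u v (g⁻¹ * x * g) (g⁻¹ * y * g)

namespace NielsenEquiv

variable {G : Type*} [Group G]

theorem isNielsenStable (u v : G) : IsNielsenStable (NielsenEquiv u v) :=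
  ⟨.swap, .inv, .mul, .conj⟩

theorem of_stable {P : G → G → Prop} (hP : IsNielsenStable P) {u v u' v' : G}
    (h : NielsenEquiv u v u' v') (huv : P u v) : P u' v' := by
  induction h with
  | refl => exact huv
  | swap x y _ ih => exact hP.swap _ _ ih
  | inv x y _ ih => exact hP.inv _ _ ih
  | mul x y _ ih => exact hP.mul _ _ ih
  | conj g x y _ ih => exact hP.conj _ _ _ ih

theorem trans {u v u' v' u'' v'' : G} (h : NielsenEquiv u v u' v')
    (h' : NielsenEquiv u' v' u'' v'') : NielsenEquiv u v u'' v'' :=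
  of_stable (isNielsenStable u v) h' h

theorem symm {u v u' v' : G} (h : NielsenEquiv u v u' v') : NielsenEquiv u' v' u v := by
  induction h with
  | refl => exact .refl
  | swap x y _ ih => exact trans (.swap _ _ .refl) ih
  | inv x y _ ih =>
    refine trans ?_ ih
    simpa using NielsenEquiv.inv x⁻¹ y (.refl (u := x⁻¹) (v := y))
  | mul x y _ ih =>
    refine trans ?_ ih
    have h1 : NielsenEquiv (x * y) y (x * y) y⁻¹ := .swap _ _ (.inv _ _ (.swap _ _ .refl))
    have h2 := NielsenEquiv.swap _ _ (.inv _ _ (.swap _ _ (.mul _ _ h1)))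
    simpa using h2
  | conj g x y _ ih =>
    refine trans ?_ ih
    have h1 := NielsenEquiv.conj g⁻¹ _ _ (.refl (u := g⁻¹ * x * g) (v := g⁻¹ * y * g))
    have e (x : G) : g⁻¹⁻¹ * (g⁻¹ * x * g) * g⁻¹ = x := by group
    rwa [e, e] at h1

end NielsenEquiv

theorem isNielsenStable_closure_eq_top {G : Type*} [Group G] :
    IsNielsenStable fun u v : G => Subgroup.closure {u, v} = ⊤ := by
  have key : ∀ {u v u' v' : G}, Subgroup.closure {u, v} = ⊤ →
      u ∈ Subgroup.closure {u', v'} → v ∈ Subgroup.closure {u', v'} →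
      Subgroup.closure {u', v'} = ⊤ := by
    intro u v u' v' h hu hv
    rw [eq_top_iff, ← h, Subgroup.closure_le]
    rintro x (rfl | rfl)
    exacts [hu, hv]
  have ml : ∀ u v : G, u ∈ Subgroup.closure {u, v} := fun u v => Subgroup.subset_closure (by simp)
  have mr : ∀ u v : G, v ∈ Subgroup.closure {u, v} := fun u v => Subgroup.subset_closure (by simp)
  refine ⟨fun u v h => ?_, fun u v h => ?_, fun u v h => ?_, fun g u v h => ?_⟩
  · exact key h (mr _ _) (ml _ _)
  · exact key h (by simpa using inv_mem (ml u⁻¹ v)) (mr _ _)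
  · exact key h (by simpa using mul_mem (ml (u * v) v) (inv_mem (mr (u * v) v))) (mr _ _)
  · have e : (MulAut.conj g⁻¹).toMonoidHom '' {u, v} = {g⁻¹ * u * g, g⁻¹ * v * g} := by
      simp [Set.image_pair]
    rw [← e, ← MonoidHom.map_closure, h, ← MonoidHom.range_eq_map, MonoidHom.range_eq_top]
    exact (MulAut.conj g⁻¹).surjective

/-! ### Minimal pairs and Nielsen's theorem in rank two -/

namespace FreeGroup

variable {α : Type*} [DecidableEq α]

/-- A pair of least total length in its Nielsen class. -/
def IsMinimalPair (u v : FreeGroup α) : Prop :=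
  ∀ u' v', NielsenEquiv u v u' v' → norm u + norm v ≤ norm u' + norm v'

namespace IsMinimalPair

variable {u v : FreeGroup α}

theorem swap (h : IsMinimalPair u v) : IsMinimalPair v u := fun u' v' h' => by
  have := h u' v' (.trans (.swap _ _ .refl) h')
  omega

theorem inv_left (h : IsMinimalPair u v) : IsMinimalPair u⁻¹ v := fun u' v' h' => by
  rw [norm_inv_eq]
  exact h u' v' (.trans (.inv _ _ .refl) h')

theorem inv_right (h : IsMinimalPair u v) : IsMinimalPair u v⁻¹ := h.swap.inv_left.swap

theorem two_mul_gromov_le_right (h : IsMinimalPair u v) : 2 * gromov u⁻¹ v ≤ norm v := by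
  have h1 := h _ _ (.mul _ _ .refl)
  have h2 := norm_inv_mul u⁻¹ v
  rw [inv_inv, norm_inv_eq] at h2
  omega

theorem two_mul_gromov_le_left (h : IsMinimalPair u v) : 2 * gromov u⁻¹ v ≤ norm u := by
  have := h.swap.inv_left.inv_right.two_mul_gromov_le_right
  rwa [inv_inv, gromov_comm, norm_inv_eq] at this

/-- By minimality each cancellation is at most half of `u`. If both were half, `u` and `u⁻¹` would
share half their letters with `v⁻¹`, hence with each other, which is impossible. -/
theorem gromov_add_gromov_inv_lt (h : IsMinimalPair u v) (hu : u ≠ 1) :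
    gromov v⁻¹ u + gromov u⁻¹ v⁻¹ < norm u := by
  have h1 := h.swap.two_mul_gromov_le_right
  have h2 := h.inv_right.two_mul_gromov_le_left
  have h3 := gromov_ultra u⁻¹ v⁻¹ u
  have h4 := two_mul_gromov_inv_self_lt hu
  omega

/-- Otherwise both cancellations are half of `u`, so u = p q⁻¹ and v = q m p⁻¹ with |p| = |q|.
Conjugating (v u, u) by q gives (m, q⁻¹ p), of total length at most |v|. Admitting conjugation as a
move replaces the usual ordering of half-words. -/
theorem gromov_add_gromov_lt (h : IsMinimalPair u v) (hu : u ≠ 1) :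
    gromov v⁻¹ u + gromov u⁻¹ v < norm u := by
  have h1 := h.swap.two_mul_gromov_le_right
  have h1' := h.swap.two_mul_gromov_le_left
  have h2 := h.two_mul_gromov_le_left
  by_contra hlt
  obtain ⟨q, hq, hqv⟩ := exists_prefix v (gromov v⁻¹ u) (by omega)
  have hpos : norm u ≠ 0 := fun h0 => hu (norm_eq_zero.1 h0)
  have e1 := norm_inv_mul v⁻¹ u
  have e2 := norm_inv_mul u⁻¹ v
  have e3 := norm_inv_mul u⁻¹ q
  have e4 := norm_inv_mul v (v * u)
  have e5 := norm_inv_mul u⁻¹ (v * u)⁻¹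
  have e6 := gromov_ultra q v u⁻¹
  have e7 := gromov_ultra q v (v * u)
  have e8 := gromov_ultra q u⁻¹ (v * u)⁻¹
  have c1 := gromov_comm v u⁻¹
  have c2 := gromov_comm q u⁻¹
  have n1 : (u⁻¹)⁻¹ * (v * u)⁻¹ = v⁻¹ := by group
  have n2 : v⁻¹ * (v * u) = u := by group
  rw [n1] at e5
  rw [n2] at e4
  simp only [inv_inv, norm_inv_eq] at e1 e2 e3 e5
  have e9 := norm_conj_of_le_gromov (q := q) (g := v * u) (by omega) (by omega) (by omega)
  have e10 := norm_mul_le q⁻¹ (u * q)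
  rw [norm_inv_eq, ← mul_assoc] at e10
  have e11 := h _ _ (.conj q _ _ (.mul _ _ (.swap _ _ .refl)))
  omega

end IsMinimalPair

/-- By the triple condition a letter of each inner factor survives, so the product cancels against a
preceding factor exactly as its first factor does. The bound 2 is all that Nielsen's theorem needs.
-/
theorem norm_prod_of_isChain {β : Type*} (s : β → FreeGroup α) (R : β → β → Prop)
    (hpos : ∀ x, 1 ≤ norm (s x))
    (hleft : ∀ x y, R x y → 2 * gromov (s x)⁻¹ (s y) ≤ norm (s x))
    (hright : ∀ x y, R x y → 2 * gromov (s x)⁻¹ (s y) ≤ norm (s y))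
    (htriple : ∀ x y z, R x y → R y z →
      gromov (s x)⁻¹ (s y) + gromov (s y)⁻¹ (s z) < norm (s y))
    (x : β) (L : List β) (h : (x :: L).IsChain R) :
    (L ≠ [] → 2 ≤ norm ((x :: L).map s).prod) ∧
    ∀ z, R z x → gromov (s z)⁻¹ ((x :: L).map s).prod = gromov (s z)⁻¹ (s x) ∧
      gromov (s z)⁻¹ (s x) + 1 ≤ norm ((x :: L).map s).prod := by
  induction L generalizing x with
  | nil =>
    refine ⟨by simp, fun z hz => ?_⟩
    have h1 := hpos x
    have h2 := hright z x hz
    simp only [List.map_cons, List.map_nil, List.prod_cons, List.prod_nil, mul_one, true_and]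
    omega
  | cons y L ih =>
    rw [List.isChain_cons_cons] at h
    obtain ⟨-, ih⟩ := ih y h.2
    rw [List.map_cons, List.prod_cons]
    set g := ((y :: L).map s).prod with hg
    obtain ⟨ih1, ih2⟩ := ih x h.1
    have h1 := hpos x
    have h2 := hleft x y h.1
    have e1 := norm_inv_mul (s x)⁻¹ g
    have e2 := norm_inv_mul (s x) (s x * g)
    rw [inv_inv, norm_inv_eq] at e1
    rw [inv_mul_cancel_left] at e2
    refine ⟨fun _ => by omega, fun z hz => ?_⟩
    have h3 := htriple z x y hz h.1
    have h4 := gromov_ultra (s z)⁻¹ (s x) (s x * g)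
    have h5 := gromov_ultra (s z)⁻¹ (s x * g) (s x)
    have h6 := gromov_comm (s x) (s x * g)
    omega

/-- The element of the group represented by a letter, if the generators stand for `u` and `v`. -/
def letterValue {G : Type*} [Group G] (u v : G) (x : Fin 2 × Bool) : G :=
  cond x.2 (![u, v] x.1) (![u, v] x.1)⁻¹

theorem letterValue_not {G : Type*} [Group G] (u v : G) (x : Fin 2 × Bool) :
    letterValue u v (x.1, !x.2) = (letterValue u v x)⁻¹ := by
  rcases x with ⟨i, b⟩
  cases b <;> simp [letterValue]

theorem IsMinimalPair.of_letters {u v : FreeGroup α} (h : IsMinimalPair u v)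
    {x y : Fin 2 × Bool} (hxy : x.1 ≠ y.1) :
    IsMinimalPair (letterValue u v x) (letterValue u v y) := by
  have key : ∀ {u v : FreeGroup α}, IsMinimalPair u v → ∀ b c : Bool,
      IsMinimalPair (cond b u u⁻¹) (cond c v v⁻¹) := by
    intro u v h b c
    cases b <;> cases c
    exacts [h.inv_left.inv_right, h.inv_left, h.inv_right, h]
  rcases x with ⟨i, b⟩
  rcases y with ⟨j, c⟩
  fin_cases i <;> fin_cases j <;> simp at hxy
  · exact key h b c
  · exact key h.swap b c

/-- A reduced word of at least two letters in `u`, `v` has a value of length at least 2, so length 1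
leaves only the letters. -/
theorem IsMinimalPair.exists_letterValue_eq {u v w : FreeGroup α} (h : IsMinimalPair u v)
    (hu : u ≠ 1) (hv : v ≠ 1) (hgen : Subgroup.closure {u, v} = ⊤) (hw : norm w = 1) :
    ∃ x, w = letterValue u v x := by
  have hne : ∀ x, letterValue u v x ≠ 1 := by
    rintro ⟨i, b⟩
    fin_cases i <;> cases b <;> simpa [letterValue]
  have hpos : ∀ x, 1 ≤ norm (letterValue u v x) := fun x =>
    Nat.one_le_iff_ne_zero.2 fun h0 => hne x (norm_eq_zero.1 h0)
  have hself : ∀ x y : Fin 2 × Bool, (x.1 = y.1 → x.2 = y.2) → x.1 = y.1 → x = y :=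
    fun x y h1 h2 => Prod.ext h2 (h1 h2)
  have hw' : w ∈ (FreeGroup.lift ![u, v]).range := by
    rw [range_lift_eq_closure, Matrix.range_cons, Matrix.range_cons, Matrix.range_empty,
      Set.union_empty, Set.singleton_union, hgen]
    trivial
  obtain ⟨t, rfl⟩ := hw'
  have ht : FreeGroup.lift ![u, v] t = (t.toWord.map (letterValue u v)).prod := by
    conv_lhs => rw [← mk_toWord (x := t), lift_mk]
    rfl
  have hred : IsReduced t.toWord := isReduced_toWord
  rw [ht] at hw ⊢
  clear ht
  generalize t.toWord = l at hw hred ⊢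
  rcases l with _ | ⟨x, L⟩
  · simp at hw
  · have key := (norm_prod_of_isChain (letterValue u v)
      (fun a b => a.1 = b.1 → a.2 = b.2) hpos ?_ ?_ ?_ x L hred).1
    · rcases L with _ | ⟨y, L⟩
      · exact ⟨x, by simp⟩
      · have := key (by simp)
        omega
    · intro x y hxy
      by_cases h1 : x.1 = y.1
      · obtain rfl := hself x y hxy h1
        exact (two_mul_gromov_inv_self_lt (hne x)).le
      · exact (h.of_letters h1).two_mul_gromov_le_left
    · intro x y hxy
      by_cases h1 : x.1 = y.1
      · obtain rfl := hself x y hxy h1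
        exact (two_mul_gromov_inv_self_lt (hne x)).le
      · exact (h.of_letters h1).two_mul_gromov_le_right
    · intro x y z hxy hyz
      by_cases h1 : x.1 = y.1
      · obtain rfl := hself x y hxy h1
        have h2 := two_mul_gromov_inv_self_lt (hne x)
        by_cases h3 : x.1 = z.1
        · obtain rfl := hself x z hyz h3
          omega
        · have := (h.of_letters h3).two_mul_gromov_le_left
          omega
      · have h2 := (h.of_letters h1).two_mul_gromov_le_right
        by_cases h3 : y.1 = z.1
        · obtain rfl := hself y z hyz h3
          have := two_mul_gromov_inv_self_lt (hne y)
          omega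
        -- With two generators the outer letters agree up to sign: what remains are the patterns v u
        -- v and v u v⁻¹.
        · have hxz : x.1 = z.1 := by omega
          by_cases h4 : x.2 = z.2
          · obtain rfl : x = z := Prod.ext hxz h4
            exact (h.of_letters h3).gromov_add_gromov_lt (hne y)
          · have : z = (x.1, !x.2) := Prod.ext hxz.symm (by
              cases hx : x.2 <;> cases hz : z.2 <;> simp_all)
            subst this
            rw [letterValue_not]
            exact (h.of_letters (Ne.symm h1)).gromov_add_gromov_inv_lt (hne y)

/-- Otherwise the free group of rank two would be cyclic, hence commutative. -/
theorem ne_one_of_closure_pair_eq_top {u v : FreeGroup (Fin 2)}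
    (h : Subgroup.closure {u, v} = ⊤) : u ≠ 1 := by
  rintro rfl
  have hmem : ∀ w : FreeGroup (Fin 2), w ∈ Subgroup.closure {v} := fun w => by
    have : w ∈ Subgroup.closure {1, v} := h ▸ Subgroup.mem_top w
    simpa [Subgroup.closure_insert_one] using this
  obtain ⟨m, hm⟩ := Subgroup.mem_closure_singleton.1 (hmem (of 0))
  obtain ⟨n, hn⟩ := Subgroup.mem_closure_singleton.1 (hmem (of 1))
  have hcomm : (of 0 : FreeGroup (Fin 2)) * of 1 = of 1 * of 0 := by
    rw [← hm, ← hn, zpow_mul_comm]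
  exact absurd hcomm (by decide)

/-- **Nielsen's theorem** in rank two: every generating pair arises from the standard basis by
Nielsen moves. -/
theorem of_closure_pair_eq_top {P : FreeGroup (Fin 2) → FreeGroup (Fin 2) → Prop}
    (hP : IsNielsenStable P) (h0 : P (of 0) (of 1)) {u v : FreeGroup (Fin 2)}
    (h : Subgroup.closure {u, v} = ⊤) : P u v := by
  classical
  obtain ⟨⟨a, b⟩, hab, hmin⟩ : ∃ p : FreeGroup (Fin 2) × FreeGroup (Fin 2),
      NielsenEquiv u v p.1 p.2 ∧ ∀ q : FreeGroup (Fin 2) × FreeGroup (Fin 2),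
        NielsenEquiv u v q.1 q.2 → norm p.1 + norm p.2 ≤ norm q.1 + norm q.2 := by
    have hex : ∃ n : ℕ, ∃ p : FreeGroup (Fin 2) × FreeGroup (Fin 2),
      NielsenEquiv u v p.1 p.2 ∧ norm p.1 + norm p.2 = n := ⟨_, (u, v), .refl, rfl⟩
    obtain ⟨p, hp, hn⟩ := Nat.find_spec hex
    exact ⟨p, hp, fun q hq => hn ▸ Nat.find_min' hex ⟨q, hq, rfl⟩⟩
  have hgen := hab.of_stable isNielsenStable_closure_eq_top h
  have hM : IsMinimalPair a b := fun a' b' h' => hmin (a', b') (hab.trans h')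
  have ha := ne_one_of_closure_pair_eq_top hgen
  have hb := ne_one_of_closure_pair_eq_top (isNielsenStable_closure_eq_top.swap _ _ hgen)
  obtain ⟨x, hx⟩ := hM.exists_letterValue_eq ha hb hgen (norm_of 0)
  obtain ⟨y, hy⟩ := hM.exists_letterValue_eq ha hb hgen (norm_of 1)
  -- The free generators are neither equal nor inverse, so up to order and signs they are the whole
  -- minimal pair.
  have hxy : x.1 ≠ y.1 := fun h1 => by
    by_cases h2 : x.2 = y.2
    · rw [Prod.ext h1 h2, ← hy] at hx
      exact absurd hx (by decide)
    · have : y = (x.1, !x.2) := Prod.ext h1.symm (by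
        cases hx : x.2 <;> cases hz : y.2 <;> simp_all)
      rw [this, letterValue_not, ← hx] at hy
      exact absurd hy (by decide)
  refine hab.symm.of_stable hP ?_
  have hinv : ∀ c d : FreeGroup (Fin 2), ∀ e f : Bool,
      P (cond e c c⁻¹) (cond f d d⁻¹) → P c d := by
    have hl : ∀ c d : FreeGroup (Fin 2), P c⁻¹ d → P c d := fun c d h => by
      simpa using hP.inv _ _ h
    have hr : ∀ c d : FreeGroup (Fin 2), P c d⁻¹ → P c d := fun c d h =>
      hP.swap _ _ (hl _ _ (hP.swap _ _ h))
    intro c d e f h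
    cases e <;> cases f
    exacts [hl _ _ (hr _ _ h), hl _ _ h, hr _ _ h, h]
  rw [hx, hy] at h0
  rcases x with ⟨i, e⟩
  rcases y with ⟨j, f⟩
  fin_cases i <;> fin_cases j <;> simp at hxy
  · exact hinv a b e f h0
  · exact hP.swap _ _ (hinv b a e f h0)

end FreeGroup

/-- Conjugating (u v, v) by v⁻¹ gives (v u, v). -/
theorem IsNielsenStable.mul_left {G : Type*} [Group G] {P : G → G → Prop} (hP : IsNielsenStable P)
    {u v : G} (h : P u v) : P (v * u) v := by
  have := hP.conj v⁻¹ _ _ (hP.mul _ _ h)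
  simpa [mul_assoc] using this

/-! ### Euclid's algorithm on unimodular pairs -/

/-- Every property of unimodular pairs of integer vectors `(a, b)`, `(c, d)` that holds for the
standard pair and is stable under the Euclidean moves holds for all of them. -/
theorem unimodular_induction {Q : ℤ → ℤ → ℤ → ℤ → Prop} (base : Q 0 1 1 0)
    (swap : ∀ a b c d, Q a b c d → Q c d a b)
    (neg : ∀ a b c d, Q a b c d → Q (-a) (-b) c d)
    (add : ∀ a b c d, |a * d - b * c| = 1 → Q a b c d → Q (a + c) (b + d) c d)
    (a b c d : ℤ) (h : |a * d - b * c| = 1) : Q a b c d := by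
  have negl : ∀ a b c d, Q (-a) (-b) c d → Q a b c d := fun a b c d h => by
    simpa using neg _ _ _ _ h
  have negr : ∀ a b c d, Q a b (-c) (-d) → Q a b c d := fun a b c d h =>
    swap _ _ _ _ (negl _ _ _ _ (swap _ _ _ _ h))
  have horizontal : ∀ a : ℤ, Q a 1 1 0 := fun a => by
    induction a with
    | zero => exact base
    | succ n ih => simpa using add _ _ _ _ (by simp) ih
    | pred n ih =>
      have := add _ _ _ _ (by simp) (negr (-n : ℤ) 1 (-1) 0 (by simpa using ih))
      exact negr _ _ _ _ (by simpa [sub_eq_add_neg] using this)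
  have right_zero : ∀ a b c d : ℤ, |a * d - b * c| = 1 → d = 0 → Q a b c d := by
    rintro a b c d h rfl
    have h1 : |b| * |c| = 1 := by simpa [abs_mul] using h
    have hb : |b| = 1 := Int.eq_one_or_neg_one_of_mul_eq_one h1 |>.resolve_right
      (by have := abs_nonneg b; omega)
    have hc : |c| = 1 := by simpa [hb] using h1
    rcases (abs_eq zero_le_one).1 hb with rfl | rfl <;>
      rcases (abs_eq zero_le_one).1 hc with rfl | rfl
    · exact horizontal a
    · exact negr _ _ _ _ (by simpa using horizontal a)
    · exact negl _ _ _ _ (by simpa using horizontal (-a))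
    · exact negl _ _ _ _ (negr _ _ _ _ (by simpa using horizontal (-a)))
  have det_swap : ∀ a b c d : ℤ, |a * d - b * c| = 1 → |c * b - d * a| = 1 := fun a b c d h => by
    rw [← h, ← abs_neg]; ring_nf
  have det_neg : ∀ a b c d : ℤ, |a * d - b * c| = 1 → |-a * d - -b * c| = 1 := fun a b c d h => by
    rw [← h, ← abs_neg]; ring_nf
  -- Euclid's algorithm on the second coordinates: the vector with the smaller one is subtracted
  -- from the other.
  have key : ∀ (n : ℕ) (a b c d : ℤ), |a * d - b * c| = 1 → 0 ≤ b → 0 ≤ d → b + d ≤ n →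
      Q a b c d := by
    intro n
    induction n with
    | zero =>
      intro a b c d h hb hd hn
      exact right_zero a b c d h (by push_cast at hn; omega)
    | succ n ih =>
      have main : ∀ a b c d : ℤ, |a * d - b * c| = 1 → 0 ≤ d → d ≤ b → b + d ≤ n + 1 →
          Q a b c d := by
        intro a b c d h hd hdb hn
        rcases hd.eq_or_lt with hd0 | hd0
        · exact right_zero a b c d h hd0.symm
        · have hdet : |(a - c) * d - (b - d) * c| = 1 := by rw [← h]; ring_nf
          have := add _ _ _ _ hdet (ih (a - c) (b - d) c d hdet (by omega) hd (by omega))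
          simpa using this
      intro a b c d h hb hd hn
      push_cast at hn
      rcases le_total d b with hle | hle
      · exact main a b c d h hd hle hn
      · exact swap _ _ _ _ (main c d a b (det_swap _ _ _ _ h) hb hle (by omega))
  have key' : ∀ a b c d : ℤ, |a * d - b * c| = 1 → 0 ≤ b → Q a b c d := by
    intro a b c d h hb
    rcases le_total 0 d with hd | hd
    · exact key (b + d).toNat a b c d h hb hd (by omega)
    · refine negr _ _ _ _ (key (b + -d).toNat a b (-c) (-d) ?_ hb (by omega) (by omega))
      rw [← h, ← abs_neg]; ring_nf
  rcases le_total 0 b with hb | hb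
  · exact key' a b c d h hb
  · exact negl _ _ _ _ (key' _ _ _ _ (det_neg _ _ _ _ h) (by omega))

/-! ### Parents in the Farey tree -/

namespace FareyFraction

theorem den_nonneg (y : FareyFraction) : 0 ≤ den y := by
  induction y using OnePoint.rec with
  | infty => simp [den]
  | coe t => simp [den]

theorem signedNum_of_den_eq_zero (x : ℚ) {y : FareyFraction} (h : den y = 0) :
    signedNum x y = if x < 0 then -1 else 1 := by
  induction y using OnePoint.rec with
  | infty => rfl
  | coe t => simp [den] at h

theorem isCoprime_num_den (y : FareyFraction) : IsCoprime (num y) (den y) := by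
  induction y using OnePoint.rec with
  | infty => exact isCoprime_one_left
  | coe t => exact Rat.isCoprime_num_den t

theorem position_le_position_iff (x : ℚ) (y z : FareyFraction) :
    position x y ≤ position x z ↔ signedNum x y * den z ≤ signedNum x z * den y := by
  have hpos : ∀ t : ℚ, (0 : ℤ) < t.den := fun t => by exact_mod_cast t.den_pos
  induction y using OnePoint.rec with
  | infty =>
    induction z using OnePoint.rec with
    | infty => simp [position, signedNum, den]
    | coe t =>
      have := hpos t
      by_cases hx : x < 0 <;> simp [position, signedNum, den, hx]
  | coe s =>
    have := hpos s
    induction z using OnePoint.rec with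
    | infty =>
      by_cases hx : x < 0 <;> simp [position, signedNum, den, hx]
    | coe t =>
      simp [position, signedNum, den, Rat.le_iff]

theorem position_injective (x : ℚ) : Function.Injective (position x) := by
  intro y z h
  induction y using OnePoint.rec with
  | infty =>
    induction z using OnePoint.rec with
    | infty => rfl
    | coe t =>
      by_cases hx : x < 0 <;> simp [position, hx] at h
  | coe s =>
    induction z using OnePoint.rec with
    | infty =>
      by_cases hx : x < 0 <;> simp [position, hx] at h
    | coe t =>
      simpa [position] using h

theorem areNeighbors_coe_iff (x : ℚ) (y : FareyFraction) :
    AreNeighbors x y ↔ |x.num * den y - x.den * signedNum x y| = 1 := by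
  induction y using OnePoint.rec with
  | infty => by_cases hx : x < 0 <;> simp [AreNeighbors, num, den, signedNum, hx]
  | coe t => rfl

/-- `m` and `r` are the parents of `x` in the Farey tree, in terms of coordinates. -/
structure AreParents (x : ℚ) (m r : FareyFraction) : Prop where
  det : x.num * den m - x.den * signedNum x m = 1
  num_eq : x.num = signedNum x m + signedNum x r
  den_eq : (x.den : ℤ) = den m + den r

/-- The vectors of `m` and `r` form a basis of ℤ², and a neighbor is α m + β r with α − β = ±1. Its
denominator being nonnegative forces α, β ≥ 0, that is, a position between `m` and `r`; the
exceptions −m and −r at infinity are excluded by the sign convention. -/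
theorem AreParents.areDistinguishedNeighbors {x : ℚ} {m r : FareyFraction}
    (h : AreParents x m r) : AreDistinguishedNeighbors x m r := by
  have hdet := h.det
  have hq : (0 : ℤ) < x.den := by exact_mod_cast x.den_pos
  have hm0 := den_nonneg m
  have hr0 := den_nonneg r
  have hden := h.den_eq
  rw [h.num_eq, hden] at hdet
  have hmsign := signedNum_of_den_eq_zero x (y := m)
  have hrsign := signedNum_of_den_eq_zero x (y := r)
  refine ⟨?_, ?_, fun y hy => ?_⟩
  · rw [areNeighbors_coe_iff, h.det, abs_one]
  · rw [areNeighbors_coe_iff, abs_eq zero_le_one, h.num_eq, hden]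
    right
    linarith
  · rw [areNeighbors_coe_iff, abs_eq zero_le_one, h.num_eq, hden] at hy
    rw [position_le_position_iff, position_le_position_iff]
    have hb := den_nonneg y
    have hysign := signedNum_of_den_eq_zero x (y := y)
    generalize signedNum x m = m' at *
    generalize signedNum x r = r' at *
    generalize signedNum x y = a at *
    generalize den m = n at *
    generalize den r = s at *
    generalize den y = b at *
    -- Cramer's rule gives the coordinates α and β.
    have hb' : b = (r' * b - s * a) * n + (a * n - m' * b) * s := by linear_combination -b * hdet
    have ha' : a = (r' * b - s * a) * m' + (a * n - m' * b) * r' := by linear_combination -a * hdet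
    have hαβ : (r' * b - s * a) - (a * n - m' * b) = 1 ∨
        (r' * b - s * a) - (a * n - m' * b) = -1 := by
      rcases hy with hy | hy
      · left; linear_combination hy
      · right; linear_combination hy
    suffices 0 ≤ a * n - m' * b ∧ 0 ≤ r' * b - s * a by
      constructor <;> linarith [this.1, this.2, mul_comm s a]
    generalize r' * b - s * a = α at *
    generalize a * n - m' * b = β at *
    rcases hαβ with hαβ | hαβ
    · suffices 0 ≤ β by omega
      by_contra hβ
      have h1 : α * n ≤ 0 := mul_nonpos_of_nonpos_of_nonneg (by omega) hm0
      have h2 : β * s ≤ 0 := mul_nonpos_of_nonpos_of_nonneg (by omega) hr0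
      have hs : s = 0 := by
        rcases mul_eq_zero.1 (show β * s = 0 by omega) with h | h <;> omega
      have hα : α = 0 := by
        rcases mul_eq_zero.1 (show α * n = 0 by omega) with h | h <;> omega
      obtain rfl : β = -1 := by omega
      have := hysign (by omega)
      have := hrsign hs
      subst hα
      split_ifs at * <;> omega
    · suffices 0 ≤ α by omega
      by_contra hα
      have h1 : α * n ≤ 0 := mul_nonpos_of_nonpos_of_nonneg (by omega) hm0
      have h2 : β * s ≤ 0 := mul_nonpos_of_nonpos_of_nonneg (by omega) hr0
      have hs : n = 0 := by
        rcases mul_eq_zero.1 (show α * n = 0 by omega) with h | h <;> omega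
      have hβ : β = 0 := by
        rcases mul_eq_zero.1 (show β * s = 0 by omega) with h | h <;> omega
      obtain rfl : α = -1 := by omega
      have := hysign (by omega)
      have := hmsign hs
      subst hβ
      split_ifs at * <;> omega

/-- The element of `FareyFraction` with homogeneous coordinates `(a, b)`. -/
def frac (a b : ℤ) : FareyFraction :=
  if b = 0 then OnePoint.infty else (((a : ℚ) / b : ℚ) : FareyFraction)

theorem frac_neg (a b : ℤ) : frac (-a) (-b) = frac a b := by
  simp [frac, neg_div_neg_eq]

theorem frac_num_den (y : FareyFraction) : frac (num y) (den y) = y := by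
  induction y using OnePoint.rec with
  | infty => simp [frac, den]
  | coe t =>
    have : (num (t : FareyFraction) : ℚ) / (den (t : FareyFraction) : ℚ) = t := by
      simp [num, den, Rat.num_div_den]
    rw [frac, this]
    simp [den]

theorem frac_signedNum_den (x : ℚ) (y : FareyFraction) : frac (signedNum x y) (den y) = y := by
  induction y using OnePoint.rec with
  | infty => simp [frac, den]
  | coe t => exact frac_num_den t

theorem exists_signedNum_eq (x : ℚ) {a b : ℤ} (h : IsCoprime a b) (hb : 0 ≤ b)
    (h0 : b = 0 → a = if x < 0 then -1 else 1) : ∃ y, signedNum x y = a ∧ den y = b := by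
  rcases hb.eq_or_lt with rfl | hb
  · exact ⟨OnePoint.infty, (h0 rfl).symm, rfl⟩
  · have hc : Nat.Coprime a.natAbs b.natAbs := Int.isCoprime_iff_gcd_eq_one.1 h
    exact ⟨((a / b : ℚ) : FareyFraction), Rat.num_div_eq_of_coprime hb hc,
      Rat.den_div_eq_of_coprime hb hc⟩

theorem exists_areParents_of_vectors (x : ℚ) {m n r s : ℤ} (hdet : r * n - s * m = 1)
    (hn : 0 ≤ n) (hs : 0 ≤ s) (hn0 : n = 0 → m = if x < 0 then -1 else 1)
    (hs0 : s = 0 → r = if x < 0 then -1 else 1) (hnum : x.num = m + r)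
    (hden : (x.den : ℤ) = n + s) :
    ∃ y z, AreParents x y z ∧ signedNum x y = m ∧ den y = n ∧ signedNum x z = r ∧ den z = s := by
  obtain ⟨y, hy1, hy2⟩ := exists_signedNum_eq x (a := m) (b := n)
    ⟨-s, r, by linear_combination hdet⟩ hn hn0
  obtain ⟨z, hz1, hz2⟩ := exists_signedNum_eq x (a := r) (b := s)
    ⟨n, -m, by linear_combination hdet⟩ hs hs0
  refine ⟨y, z, ⟨?_, ?_, ?_⟩, hy1, hy2, hz1, hz2⟩
  · rw [hnum, hden, hy1, hy2]; linear_combination hdet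
  · rw [hnum, hy1, hz1]
  · rw [hden, hy2, hz2]

theorem exists_areParents {x : ℚ} (hx : x ≠ 0) : ∃ m r, AreParents x m r := by
  have hq : (0 : ℤ) < x.den := by exact_mod_cast x.den_pos
  have hp : x.num ≠ 0 := Rat.num_ne_zero.2 hx
  have hneg : x < 0 ↔ x.num < 0 := Rat.num_neg.symm
  obtain ⟨u, v, huv⟩ := Rat.isCoprime_num_den x
  -- `n` inverts the numerator modulo the denominator. The choice between 0 and `x.den` arises only
  -- for integers; the sign of `x` decides whether infinity is the smallest or the largest neighbor.
  obtain ⟨n, m, hdet, hn, hnq, hn0, hnq0⟩ : ∃ n m : ℤ, x.num * n - x.den * m = 1 ∧ 0 ≤ n ∧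
      n ≤ x.den ∧ (n = 0 → x.num < 0) ∧ (n = x.den → 0 < x.num) := by
    have h1 := Int.emod_nonneg u hq.ne'
    have h2 := Int.emod_lt_of_pos u hq
    have h3 := Int.emod_add_mul_ediv u x.den
    have hdet : x.num * (u % x.den) - x.den * (-v - x.num * (u / x.den)) = 1 := by
      linear_combination huv + x.num * h3
    by_cases hc : 0 < x.num ∧ u % x.den = 0
    · refine ⟨x.den, -v - x.num * (u / x.den) + x.num, ?_, hq.le, le_rfl, by omega, fun _ => hc.1⟩
      rw [hc.2] at hdet
      linear_combination hdet
    · exact ⟨_, _, hdet, h1, h2.le, by omega, by omega⟩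
  have hm : n = 0 → m = if x < 0 then -1 else 1 := by
    intro h0
    rw [if_pos (hneg.2 (hn0 h0))]
    rw [h0] at hdet
    have : x.den * -m = 1 := by linear_combination hdet
    rcases Int.eq_one_or_neg_one_of_mul_eq_one' this with h | h <;> omega
  have hr : (x.den : ℤ) - n = 0 → x.num - m = if x < 0 then -1 else 1 := by
    intro h0
    have hpos := hnq0 (by omega)
    rw [if_neg (by rw [hneg]; omega)]
    have : x.den * (x.num - m) = 1 := by
      rw [show n = x.den by omega] at hdet
      linear_combination hdet
    rcases Int.eq_one_or_neg_one_of_mul_eq_one' this with h | h <;> omega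
  obtain ⟨y, z, h, -⟩ := exists_areParents_of_vectors x (m := m) (n := n) (r := x.num - m)
    (s := x.den - n) (by linear_combination hdet) hn (by omega) hm hr (by ring) (by ring)
  exact ⟨y, z, h⟩

theorem AreDistinguishedNeighbors.unique {x : ℚ} {m r m' r' : FareyFraction}
    (h : AreDistinguishedNeighbors x m r) (h' : AreDistinguishedNeighbors x m' r') :
    m = m' ∧ r = r' :=
  ⟨position_injective x (le_antisymm (h.2.2 m' h'.1).1 (h'.2.2 m h.1).1),
    position_injective x (le_antisymm (h'.2.2 r h.2.1).2 (h.2.2 r' h'.2.1).2)⟩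

theorem AreParents.position_lt {x : ℚ} {m r : FareyFraction} (h : AreParents x m r) :
    position x m < position x x ∧ position x x < position x r := by
  have h1 := h.det
  have h2 := h.num_eq
  have h3 := h.den_eq
  have e1 : signedNum x x = x.num := rfl
  have e2 : den (x : FareyFraction) = x.den := rfl
  have h4 : x.den * signedNum x r - x.num * den r = 1 := by
    linear_combination h1 + x.num * h3 - x.den * h2
  constructor
  · rw [← not_le, position_le_position_iff, e1, e2]
    linarith [mul_comm (x.den : ℤ) (signedNum x m)]
  · rw [← not_le, position_le_position_iff, e1, e2]
    linarith [mul_comm (x.den : ℤ) (signedNum x r)]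

/-- The sum of the absolute values of numerator and denominator. -/
def height (y : FareyFraction) : ℕ := (num y).natAbs + (den y).natAbs

theorem height_eq (x : ℚ) (y : FareyFraction) :
    height y = (signedNum x y).natAbs + (den y).natAbs := by
  induction y using OnePoint.rec with
  | infty => by_cases hx : x < 0 <;> simp [height, num, den, signedNum, hx]
  | coe t => rfl

/-- The numerators of the parents have weakly the sign of `x`, so heights add, and both are
positive. -/
theorem AreParents.height_lt {x : ℚ} {m r : FareyFraction} (hx : x ≠ 0) (h : AreParents x m r) :
    height m < height x ∧ height r < height x := by
  have h1 := h.det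
  have h2 := h.num_eq
  have h3 := h.den_eq
  have hm := den_nonneg m
  have hr := den_nonneg r
  have hq : (0 : ℤ) < x.den := by exact_mod_cast x.den_pos
  have hp : x.num ≠ 0 := Rat.num_ne_zero.2 hx
  have hneg : x < 0 ↔ x.num < 0 := Rat.num_neg.symm
  have hm0 := signedNum_of_den_eq_zero x (y := m)
  have hr0 := signedNum_of_den_eq_zero x (y := r)
  have h4 : x.den * signedNum x r - x.num * den r = 1 := by
    linear_combination h1 + x.num * h3 - x.den * h2
  have e : height (x : FareyFraction) = x.num.natAbs + (x.den : ℤ).natAbs := rfl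
  rw [height_eq x m, height_eq x r, e]
  generalize signedNum x m = m' at *
  generalize signedNum x r = r' at *
  generalize den m = n at *
  generalize den r = s at *
  simp only [hneg] at hm0 hr0
  generalize x.num = p at *
  generalize (x.den : ℤ) = q at *
  rcases lt_or_gt_of_ne hp with hp | hp
  · rw [if_pos hp] at hm0 hr0
    have i1 : m' < 0 := by
      by_contra hc
      nlinarith [mul_nonneg hq.le (not_lt.1 hc), mul_nonneg hm (neg_nonneg.2 hp.le)]
    have i2 : r' ≤ 0 := by
      by_contra hc
      have : 0 < s := by
        rcases hr.eq_or_lt with h | h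
        · have := hr0 h.symm; omega
        · exact h
      nlinarith [mul_pos hq (not_le.1 hc), mul_pos this (neg_pos.2 hp)]
    have i3 : 0 < s := by
      rcases hr.eq_or_lt with h | h
      · subst h; nlinarith
      · exact h
    omega
  · rw [if_neg (by omega)] at hm0 hr0
    have i1 : 0 < r' := by
      by_contra hc
      nlinarith [mul_nonneg hq.le (neg_nonneg.2 (not_lt.1 hc)), mul_nonneg hr hp.le]
    have i3 : 0 < n := by
      rcases hm.eq_or_lt with h | h
      · have := hm0 h.symm
        subst h; nlinarith
      · exact h
    have i2 : 0 ≤ m' := by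
      by_contra hc
      nlinarith [mul_pos hq (neg_pos.2 (not_le.1 hc)), mul_pos i3 hp]
    omega

end FareyFraction

/-! ### Words of fractions and of integer vectors -/

namespace FareyFraction

section Enumeration

variable {G : Type*} [Group G]

open Classical in
/-- The word attached to a rational number by the recursion along the Farey tree. -/
noncomputable def fareyWord (A B : G) (x : ℚ) : G :=
  if hx : x = 0 then A else
    (exists_areParents hx).choose_spec.choose.elim (if x < 0 then B⁻¹ else B)
      -- The guard serves termination; by `AreParents.height_lt` the default 1 never occurs.
      (fun t => if _ht : height t < height x then fareyWord A B t else 1) *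
    (exists_areParents hx).choose.elim (if x < 0 then B⁻¹ else B)
      (fun t => if _ht : height t < height x then fareyWord A B t else 1)
termination_by height x

theorem isFareyEnumeration_fareyWord (A B : G) :
    IsFareyEnumeration A B fun y => y.elim B (fareyWord A B) := by
  refine ⟨?_, rfl, fun x m r hx h => ?_⟩
  · show fareyWord A B 0 = A
    rw [fareyWord, dif_pos rfl]
  · have hp := (exists_areParents hx).choose_spec.choose_spec
    obtain ⟨hm, hr⟩ := h.unique hp.areDistinguishedNeighbors
    obtain ⟨hltm, hltr⟩ := hp.height_lt hx
    show fareyWord A B x = _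
    rw [fareyWord, dif_neg hx]
    have key : ∀ y : FareyFraction, height y < height x →
        y.elim (if x < 0 then B⁻¹ else B)
          (fun t => if _ht : height t < height x then fareyWord A B t else 1) =
        signedWord (fun y : FareyFraction => y.elim B (fareyWord A B)) x y := by
      intro y hy
      induction y using OnePoint.rec with
      | infty => rfl
      | coe t => exact dif_pos hy
    rw [hm, hr, key _ hltr, key _ hltm]

theorem IsFareyEnumeration.eq {A B : G} {W W' : FareyFraction → G}
    (h : IsFareyEnumeration A B W) (h' : IsFareyEnumeration A B W') : W = W' := by
  funext y
  induction hn : height y using Nat.strong_induction_on generalizing y with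
  | _ n ih =>
    induction y using OnePoint.rec with
    | infty => rw [h.infty, h'.infty]
    | coe x =>
      by_cases hx : x = 0
      · rw [hx, h.zero, h'.zero]
      · obtain ⟨m, r, hmr⟩ := exists_areParents hx
        obtain ⟨hm, hr⟩ := hmr.height_lt hx
        have hd := hmr.areDistinguishedNeighbors
        have key : ∀ y : FareyFraction, height y < n → signedWord W x y = signedWord W' x y := by
          intro y hy
          induction y using OnePoint.rec with
          | infty => simp [signedWord, h.infty, h'.infty]
          | coe t => exact ih _ hy _ rfl
        rw [h.mul x m r hx hd, h'.mul x m r hx hd, key m (hn ▸ hm), key r (hn ▸ hr)]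

/-- The word attached to the integer vector `(a, b)` by a family of words indexed by fractions:
opposite vectors carry inverse words. -/
def vectorWord (W : FareyFraction → G) (a b : ℤ) : G :=
  W (frac a b) ^ (if b = 0 then a.sign else b.sign)

variable (W : FareyFraction → G)

theorem vectorWord_neg (a b : ℤ) : vectorWord W (-a) (-b) = (vectorWord W a b)⁻¹ := by
  rw [vectorWord, vectorWord, frac_neg, ← zpow_neg]
  by_cases hb : b = 0 <;> simp [hb]

theorem vectorWord_signedNum (x : ℚ) (y : FareyFraction) :
    vectorWord W (signedNum x y) (den y) = signedWord W x y := by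
  rw [vectorWord, frac_signedNum_den]
  induction y using OnePoint.rec with
  | infty => by_cases hx : x < 0 <;> simp [signedNum, den, signedWord, hx]
  | coe t => simp [den, signedWord, Int.sign_natCast_of_ne_zero]

theorem vectorWord_num (y : FareyFraction) : vectorWord W (num y) (den y) = W y := by
  rw [vectorWord, frac_num_den]
  induction y using OnePoint.rec with
  | infty => simp [num, den]
  | coe t => simp [den, Int.sign_natCast_of_ne_zero]

theorem vectorWord_eq_or {a b : ℤ} (h : IsCoprime a b) :
    vectorWord W a b = W (frac a b) ∨ vectorWord W a b = (W (frac a b))⁻¹ := by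
  have key : ∀ c : ℤ, c ≠ 0 → W (frac a b) ^ c.sign = W (frac a b) ∨
      W (frac a b) ^ c.sign = (W (frac a b))⁻¹ := fun c hc => by
    rcases lt_or_gt_of_ne hc with hc | hc
    · right; simp [Int.sign_eq_neg_one_of_neg hc]
    · left; simp [Int.sign_eq_one_of_pos hc]
  rw [vectorWord]
  split_ifs with hb
  · refine key a fun ha => ?_
    rw [ha, hb] at h
    exact not_isCoprime_zero_zero h
  · exact key b hb

/-- The word of `(a, b) + (c, d)` is the product of the words of `(a, b)` and `(c, d)`, in one of
the two orders. -/
def IsMulVectorWord (a b c d : ℤ) : Prop :=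
  vectorWord W (a + c) (b + d) = vectorWord W a b * vectorWord W c d ∨
    vectorWord W (a + c) (b + d) = vectorWord W c d * vectorWord W a b

variable {W}

theorem IsMulVectorWord.swap {a b c d : ℤ} (h : IsMulVectorWord W a b c d) :
    IsMulVectorWord W c d a b := by
  rw [IsMulVectorWord, add_comm c a, add_comm d b]
  exact Or.symm h

theorem IsMulVectorWord.of_neg {a b c d : ℤ} (h : IsMulVectorWord W (-a) (-b) (-c) (-d)) :
    IsMulVectorWord W a b c d := by
  rw [IsMulVectorWord, ← neg_add, ← neg_add, vectorWord_neg, vectorWord_neg, vectorWord_neg,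
    ← mul_inv_rev, ← mul_inv_rev, inv_inj, inv_inj] at h
  exact Or.symm h

/-- The relation is symmetric in v, w, v + w up to signs, as v = (v + w) + (−w). -/
theorem IsMulVectorWord.of_sub {a b c d : ℤ} (h : IsMulVectorWord W (a + c) (b + d) (-c) (-d)) :
    IsMulVectorWord W a b c d := by
  rw [IsMulVectorWord, vectorWord_neg, add_neg_cancel_right, add_neg_cancel_right,
    eq_mul_inv_iff_mul_eq, eq_inv_mul_iff_mul_eq] at h
  exact h.imp Eq.symm Eq.symm

variable {A B : G}

/-- This is the defining recursion; the conditions at `n = 0` and `s = 0` give a vector at infinity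
the sign of the mediant. -/
theorem IsFareyEnumeration.vectorWord_add_of_parents (hW : IsFareyEnumeration A B W)
    {m n r s : ℤ} (hdet : r * n - s * m = 1) (hn : 0 ≤ n) (hs : 0 ≤ s) (hn0 : n = 0 → r ≤ 0)
    (hs0 : s = 0 → 0 ≤ m) : IsMulVectorWord W m n r s := by
  right
  have hn1 : n = 0 → m = -1 := fun h => by
    rw [h] at hdet
    have : s * -m = 1 := by linear_combination hdet
    rcases Int.eq_one_or_neg_one_of_mul_eq_one' this with h | h <;> omega
  have hs1 : s = 0 → r = 1 := fun h => by
    rw [h] at hdet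
    have : n * r = 1 := by linear_combination hdet
    rcases Int.eq_one_or_neg_one_of_mul_eq_one' this with h | h <;> omega
  have hpos : 0 < n + s := by
    rcases hn.eq_or_lt with h | h
    · rcases hs.eq_or_lt with h' | h'
      · rw [← h, ← h'] at hdet; simp at hdet
      · omega
    · omega
  have hne : m + r ≠ 0 := fun h => by
    have h1 : r * (n + s) = 1 := by linear_combination hdet + s * h
    rcases Int.eq_one_or_neg_one_of_mul_eq_one' h1 with h2 | h2 <;> omega
  have hcop : Nat.Coprime (m + r).natAbs (n + s).natAbs :=
    Int.isCoprime_iff_gcd_eq_one.1 ⟨n, -m, by linear_combination hdet⟩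
  obtain ⟨x, hx⟩ : ∃ x : ℚ, x = ((m + r : ℤ) : ℚ) / (n + s : ℤ) := ⟨_, rfl⟩
  have hnum : x.num = m + r := hx ▸ Rat.num_div_eq_of_coprime hpos hcop
  have hden : (x.den : ℤ) = n + s := hx ▸ Rat.den_div_eq_of_coprime hpos hcop
  have hneg : x < 0 ↔ m + r < 0 := by rw [← hnum]; exact Rat.num_neg.symm
  have hx0 : x ≠ 0 := fun h => hne (by rw [← hnum, h]; rfl)
  obtain ⟨y, z, h, h1, h2, h3, h4⟩ := exists_areParents_of_vectors x hdet hn hs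
    (fun h0 => by
      have := hn0 h0
      rw [hn1 h0, if_pos (hneg.2 (by have := hn1 h0; omega))])
    (fun h0 => by
      have := hs0 h0
      rw [hs1 h0, if_neg (by rw [hneg]; have := hs1 h0; omega)]) hnum hden
  have := hW.mul x y z hx0 h.areDistinguishedNeighbors
  rw [← vectorWord_num W x, ← vectorWord_signedNum, ← vectorWord_signedNum, h1, h2, h3, h4] at this
  rw [← this, ← hnum, ← hden]
  rfl

/-- Parents fail only when infinity has the wrong sign, as in (−1, 0) + (r, 1) with r > 0. This is
the recursion for (r − 1, 1) + (1, 0), rearranged. -/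
theorem IsFareyEnumeration.vectorWord_add_of_nonneg (hW : IsFareyEnumeration A B W)
    {a b c d : ℤ} (hdet : |a * d - b * c| = 1) (hb : 0 ≤ b) (hd : 0 ≤ d) :
    IsMulVectorWord W a b c d := by
  have main : ∀ {m n r s : ℤ}, r * n - s * m = 1 → 0 ≤ n → 0 ≤ s → IsMulVectorWord W m n r s := by
    intro m n r s hdet hn hs
    by_cases h0 : n = 0 ∧ 0 < r
    · obtain ⟨rfl, hr⟩ := h0
      have : s * -m = 1 := by linear_combination hdet
      have hs1 : s = 1 := by
        rcases Int.eq_one_or_neg_one_of_mul_eq_one this with h | h <;> omega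
      have hm1 : m = -1 := by rw [hs1] at this; omega
      subst hs1 hm1
      have := hW.vectorWord_add_of_parents (m := r - 1) (n := 1) (r := 1) (s := 0) (by ring)
        (by omega) le_rfl (by omega) (by omega)
      exact (IsMulVectorWord.of_sub (by simpa [neg_add_eq_sub, sub_eq_add_neg, add_comm] using this)
        : IsMulVectorWord W r 1 (-1) 0).swap
    · by_cases h1 : s = 0 ∧ m < 0
      · obtain ⟨rfl, hm⟩ := h1
        have : n * r = 1 := by linear_combination hdet
        have hn1 : n = 1 := by
          rcases Int.eq_one_or_neg_one_of_mul_eq_one this with h | h <;> omega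
        have hr1 : r = 1 := by rw [hn1] at this; omega
        subst hn1 hr1
        have := hW.vectorWord_add_of_parents (m := -1) (n := 0) (r := m + 1) (s := 1) (by ring)
          le_rfl (by omega) (by omega) (by omega)
        exact IsMulVectorWord.of_sub (by simpa using this.swap)
      · exact hW.vectorWord_add_of_parents hdet hn hs (by omega) (by omega)
  rcases (abs_eq zero_le_one).1 hdet with h | h
  · exact (main (by linear_combination h) hd hb).swap
  · exact main (by linear_combination -h) hb hd

/-- For second coordinates of opposite sign, rewriting the relation as v = (v + w) + (−w) or −w = v
+ (−(v + w)) makes both summands nonnegative there. -/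
theorem IsFareyEnumeration.vectorWord_add (hW : IsFareyEnumeration A B W)
    {a b c d : ℤ} (hdet : |a * d - b * c| = 1) : IsMulVectorWord W a b c d := by
  have mixed : ∀ {a b c d : ℤ}, |a * d - b * c| = 1 → 0 ≤ b → d ≤ 0 →
      IsMulVectorWord W a b c d := by
    intro a b c d hdet hb hd
    rcases le_total 0 (b + d) with h | h
    · refine (hW.vectorWord_add_of_nonneg ?_ h (by omega)).of_sub
      rw [← hdet, ← abs_neg]; ring_nf
    · refine (IsMulVectorWord.of_neg ?_).swap
      refine IsMulVectorWord.of_sub ?_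
      rw [neg_neg, neg_neg]
      refine hW.vectorWord_add_of_nonneg ?_ (by omega) hb
      rw [← hdet]; ring_nf
  rcases le_total 0 b with hb | hb <;> rcases le_total 0 d with hd | hd
  · exact hW.vectorWord_add_of_nonneg hdet hb hd
  · exact mixed hdet hb hd
  · refine (mixed ?_ hd hb).swap
    rw [← hdet, ← abs_neg]; ring_nf
  · refine (hW.vectorWord_add_of_nonneg ?_ (by omega) (by omega)).of_neg
    rw [← hdet]; ring_nf

theorem IsFareyEnumeration.vectorWord_zero_one (hW : IsFareyEnumeration A B W) :
    vectorWord W 0 1 = A := by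
  rw [← hW.zero, ← vectorWord_num W ((0 : ℚ) : FareyFraction)]
  rfl

theorem IsFareyEnumeration.vectorWord_one_zero (hW : IsFareyEnumeration A B W) :
    vectorWord W 1 0 = B := by
  rw [← hW.infty, ← vectorWord_num W OnePoint.infty]
  rfl

theorem IsFareyEnumeration.closure_eq_top (hW : IsFareyEnumeration A B W)
    (hAB : Subgroup.closure {A, B} = ⊤) {a b c d : ℤ} (hdet : |a * d - b * c| = 1) :
    Subgroup.closure {vectorWord W a b, vectorWord W c d} = ⊤ := by
  have hN := isNielsenStable_closure_eq_top (G := G)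
  refine unimodular_induction
    (Q := fun a b c d => Subgroup.closure {vectorWord W a b, vectorWord W c d} = ⊤)
    ?_ ?_ ?_ ?_ a b c d hdet
  · rwa [hW.vectorWord_zero_one, hW.vectorWord_one_zero]
  · exact fun a b c d h => hN.swap _ _ h
  · intro a b c d h
    rw [vectorWord_neg]
    exact hN.inv _ _ h
  · intro a b c d hdet h
    rcases hW.vectorWord_add hdet with e | e <;> rw [e]
    · exact hN.mul _ _ h
    · exact hN.mul_left h

theorem IsFareyEnumeration.map_vectorWord (hW : IsFareyEnumeration A B W)
    (φ : G →* Multiplicative (ℤ × ℤ)) (hA : φ A = Multiplicative.ofAdd (0, 1))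
    (hB : φ B = Multiplicative.ofAdd (1, 0)) {a b c d : ℤ} (hdet : |a * d - b * c| = 1) :
    φ (vectorWord W a b) = Multiplicative.ofAdd (a, b) := by
  refine (unimodular_induction
    (Q := fun a b c d => φ (vectorWord W a b) = Multiplicative.ofAdd (a, b) ∧
      φ (vectorWord W c d) = Multiplicative.ofAdd (c, d)) ?_ ?_ ?_ ?_ a b c d hdet).1
  · rw [hW.vectorWord_zero_one, hW.vectorWord_one_zero]
    exact ⟨hA, hB⟩
  · exact fun a b c d h => h.symm
  · intro a b c d h
    rw [vectorWord_neg, map_inv, h.1]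
    exact ⟨rfl, h.2⟩
  · intro a b c d hdet h
    refine ⟨?_, h.2⟩
    have : φ (vectorWord W (a + c) (b + d)) = φ (vectorWord W a b) * φ (vectorWord W c d) := by
      rcases hW.vectorWord_add hdet with e | e
      · rw [e, map_mul]
      · rw [e, map_mul, mul_comm]
    rw [this, h.1, h.2]
    rfl

/-- The pair `(u, v)` is simultaneously conjugate to the words of a unimodular pair of vectors. -/
def IsConjVectorWords (W : FareyFraction → G) (u v : G) : Prop :=
  ∃ (g : G) (a b c d : ℤ), |a * d - b * c| = 1 ∧ u = g⁻¹ * vectorWord W a b * g ∧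
    v = g⁻¹ * vectorWord W c d * g

theorem IsFareyEnumeration.isNielsenStable (hW : IsFareyEnumeration A B W) :
    IsNielsenStable (IsConjVectorWords W) := by
  refine ⟨?_, ?_, ?_, ?_⟩
  · rintro _ _ ⟨g, a, b, c, d, h, rfl, rfl⟩
    refine ⟨g, c, d, a, b, ?_, rfl, rfl⟩
    rw [← h, ← abs_neg]; ring_nf
  · rintro _ _ ⟨g, a, b, c, d, h, rfl, rfl⟩
    refine ⟨g, -a, -b, c, d, ?_, ?_, rfl⟩
    · rw [← h, ← abs_neg]; ring_nf
    · rw [vectorWord_neg]; group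
  · rintro _ _ ⟨g, a, b, c, d, h, rfl, rfl⟩
    have hdet : |(a + c) * d - (b + d) * c| = 1 := by rw [← h]; ring_nf
    rcases hW.vectorWord_add h with e | e
    · exact ⟨g, a + c, b + d, c, d, hdet, by rw [e]; group, rfl⟩
    -- The wrong order is repaired by conjugating with the word of `(c, d)`, which commutes with
    -- itself.
    · exact ⟨vectorWord W c d * g, a + c, b + d, c, d, hdet, by rw [e]; group, by group⟩
  · rintro k _ _ ⟨g, a, b, c, d, h, rfl, rfl⟩
    exact ⟨g * k, a, b, c, d, h, by group, by group⟩

end Enumeration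

end FareyFraction

/-! ### Transport to an arbitrary basis -/

theorem FreeGroupBasis.closure_pair_eq_top {G : Type*} [Group G] (b : FreeGroupBasis (Fin 2) G) :
    Subgroup.closure {b 0, b 1} = ⊤ := by
  have h := FreeGroup.closure_range_of (Fin 2)
  have e : b.repr.symm.toMonoidHom '' Set.range FreeGroup.of = {b 0, b 1} := by
    rw [← Set.range_comp]
    ext x
    simp only [Set.mem_range, Fin.exists_fin_two, Set.mem_insert_iff, Set.mem_singleton_iff]
    exact or_congr eq_comm eq_comm
  rw [← e, ← MonoidHom.map_closure, h, ← MonoidHom.range_eq_map, MonoidHom.range_eq_top]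
  exact b.repr.symm.surjective

theorem FreeGroupBasis.of_closure_pair_eq_top {G : Type*} [Group G]
    (b : FreeGroupBasis (Fin 2) G) {P : G → G → Prop} (hP : IsNielsenStable P)
    (h0 : P (b 0) (b 1)) {u v : G} (h : Subgroup.closure {u, v} = ⊤) : P u v := by
  have h' : Subgroup.closure {b.repr u, b.repr v} = ⊤ := by
    have e : b.repr.toMonoidHom '' {u, v} = {b.repr u, b.repr v} := Set.image_pair _ _ _
    rw [← e, ← MonoidHom.map_closure, h, ← MonoidHom.range_eq_map, MonoidHom.range_eq_top]
    exact b.repr.surjective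
  have hQ : IsNielsenStable fun s t => P (b.repr.symm s) (b.repr.symm t) := by
    refine ⟨fun s t => hP.swap _ _, fun s t h => ?_, fun s t h => ?_, fun g s t h => ?_⟩
    · simpa using hP.inv _ _ h
    · simpa using hP.mul _ _ h
    · simpa using hP.conj (b.repr.symm g) _ _ h
  simpa using FreeGroup.of_closure_pair_eq_top hQ h0 h'

/-! ### Exponent sums and the classification -/

namespace FareyFraction

theorem exists_det_eq_one (y : FareyFraction) : ∃ c d : ℤ, |num y * d - den y * c| = 1 := by
  obtain ⟨u, v, h⟩ := isCoprime_num_den y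
  exact ⟨-v, u, by rw [show num y * u - den y * -v = 1 by linear_combination h, abs_one]⟩

variable {G : Type*} [Group G] {b : FreeGroupBasis (Fin 2) G} {W : FareyFraction → G}

/-- The exponent sums of `b 1` and `b 0`. -/
def exponents (b : FreeGroupBasis (Fin 2) G) : G →* Multiplicative (ℤ × ℤ) :=
  b.lift ![Multiplicative.ofAdd (0, 1), Multiplicative.ofAdd (1, 0)]

theorem IsFareyEnumeration.exponents_vectorWord (hW : IsFareyEnumeration (b 0) (b 1) W)
    {p q r s : ℤ} (hdet : |p * s - q * r| = 1) :
    exponents b (vectorWord W p q) = Multiplicative.ofAdd (p, q) :=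
  hW.map_vectorWord _ (by simp [exponents]) (by simp [exponents]) hdet

theorem IsFareyEnumeration.exponents_apply (hW : IsFareyEnumeration (b 0) (b 1) W)
    (y : FareyFraction) : exponents b (W y) = Multiplicative.ofAdd (num y, den y) := by
  obtain ⟨c, d, h⟩ := exists_det_eq_one y
  rw [← vectorWord_num W y, hW.exponents_vectorWord h]

theorem exponents_surjective : Function.Surjective (exponents b) := by
  intro t
  refine ⟨b 0 ^ t.toAdd.2 * b 1 ^ t.toAdd.1, ?_⟩
  rw [map_mul, map_zpow, map_zpow, exponents, FreeGroupBasis.lift_apply_apply,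
    FreeGroupBasis.lift_apply_apply]
  apply Multiplicative.toAdd.injective
  ext <;> simp

theorem IsFareyEnumeration.arePrimitiveAssociates_iff (hW : IsFareyEnumeration (b 0) (b 1) W)
    (x y : FareyFraction) :
    ArePrimitiveAssociates (W x) (W y) ↔ |num x * den y - den x * num y| = 1 := by
  constructor
  · intro h
    have hx := hW.exponents_apply x
    have hy := hW.exponents_apply y
    have htop : Subgroup.closure {exponents b (W x), exponents b (W y)} = ⊤ := by
      rw [← Set.image_pair, ← MonoidHom.map_closure, show Subgroup.closure {W x, W y} = ⊤ from h,
        ← MonoidHom.range_eq_map, MonoidHom.range_eq_top]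
      exact exponents_surjective
    have key : ∀ t : ℤ × ℤ, ∃ m n : ℤ, m * num x + n * num y = t.1 ∧
        m * den x + n * den y = t.2 := fun t => by
      have ht : Multiplicative.ofAdd t ∈
          Subgroup.closure {exponents b (W x), exponents b (W y)} := htop ▸ Subgroup.mem_top _
      obtain ⟨m, n, hmn⟩ := Subgroup.mem_closure_pair.1 ht
      rw [hx, hy, ← ofAdd_zsmul, ← ofAdd_zsmul, ← ofAdd_add, EmbeddingLike.apply_eq_iff_eq] at hmn
      exact ⟨m, n, by rw [← hmn]; simp, by rw [← hmn]; simp⟩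
    obtain ⟨i, j, h1, h2⟩ := key (1, 0)
    obtain ⟨k, l, h3, h4⟩ := key (0, 1)
    simp only at h1 h2 h3 h4
    -- The coefficients expressing the standard basis of ℤ² through the exponent vectors form an
    -- inverse matrix, so the two integer determinants multiply to 1.
    refine Int.isUnit_iff_abs_eq.1 (IsUnit.of_mul_eq_one (i * l - j * k) ?_)
    linear_combination (k * den x + l * den y) * h1 + h4 - (k * num x + l * num y) * h2
  · intro h
    have := hW.closure_eq_top b.closure_pair_eq_top h
    rwa [vectorWord_num, vectorWord_num] at this

theorem IsFareyEnumeration.isPrimitiveWord (hW : IsFareyEnumeration (b 0) (b 1) W)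
    (x : FareyFraction) : IsPrimitiveWord (W x) := by
  obtain ⟨c, d, h⟩ := exists_det_eq_one x
  refine ⟨vectorWord W c d, ?_⟩
  have := hW.closure_eq_top b.closure_pair_eq_top h
  rwa [vectorWord_num] at this

/-- Nielsen's theorem supplies a conjugate vector word; exponent sums, being conjugation invariant,
recover (p, q) up to sign and hence the fraction. -/
theorem IsFareyEnumeration.existsUnique_isConj (hW : IsFareyEnumeration (b 0) (b 1) W)
    {w : G} (hw : IsPrimitiveWord w) :
    ∃! x : FareyFraction, IsConj w (W x) ∨ IsConj w (W x)⁻¹ := by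
  obtain ⟨v, hv⟩ := hw
  have h0 : IsConjVectorWords W (b 0) (b 1) :=
    ⟨1, 0, 1, 1, 0, by simp, by simp [hW.vectorWord_zero_one], by simp [hW.vectorWord_one_zero]⟩
  obtain ⟨g, p, q, r, s, hdet, hg, -⟩ := b.of_closure_pair_eq_top hW.isNielsenStable h0 hv
  have hcop : IsCoprime p q := by
    rcases (abs_eq zero_le_one).1 hdet with h | h
    · exact ⟨s, -r, by linear_combination h⟩
    · exact ⟨-s, r, by linear_combination -h⟩
  have hconj : IsConj w (vectorWord W p q) := isConj_iff.2 ⟨g, by rw [hg]; group⟩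
  refine ⟨frac p q, ?_, fun y hy => ?_⟩
  · rcases vectorWord_eq_or W hcop with h | h
    · exact Or.inl (h ▸ hconj)
    · exact Or.inr (h ▸ hconj)
  · have e : exponents b w = Multiplicative.ofAdd (p, q) := by
      rw [← hW.exponents_vectorWord hdet]
      exact isConj_iff_eq.1 ((exponents b).map_isConj hconj)
    have ey := hW.exponents_apply y
    rcases hy with hy | hy
    · have h := isConj_iff_eq.1 ((exponents b).map_isConj hy)
      rw [e, ey, EmbeddingLike.apply_eq_iff_eq, Prod.mk.injEq] at h
      rw [h.1, h.2, frac_num_den]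
    · have h := isConj_iff_eq.1 ((exponents b).map_isConj hy)
      rw [map_inv, e, ey, ← ofAdd_neg, EmbeddingLike.apply_eq_iff_eq, Prod.neg_mk,
        Prod.mk.injEq] at h
      rw [h.1, h.2, frac_neg, frac_num_den]

end FareyFraction

theorem mainTheorem2 {G : Type*} [Group G] (b : FreeGroupBasis (Fin 2) G) :
    -- every nonzero rational number has distinguished neighbors, lies between them, and is their
    -- Farey sum
    (∀ x : ℚ, x ≠ 0 → ∃ m r : FareyFraction,
      FareyFraction.AreDistinguishedNeighbors x m r ∧
      FareyFraction.position x m < FareyFraction.position x x ∧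
      FareyFraction.position x x < FareyFraction.position x r ∧
      FareyFraction.num x = FareyFraction.signedNum x m + FareyFraction.signedNum x r ∧
      FareyFraction.den x = FareyFraction.den m + FareyFraction.den r) ∧
    -- the recursion defines one and only one family of words
    (∃! W : FareyFraction → G, FareyFraction.IsFareyEnumeration (b 0) (b 1) W) ∧
    ∀ W : FareyFraction → G, FareyFraction.IsFareyEnumeration (b 0) (b 1) W →
      -- the family enumerates the primitive words, up to conjugation and inversion
      (∀ x : FareyFraction, IsPrimitiveWord (W x)) ∧
      (∀ w : G, IsPrimitiveWord w →
        ∃! x : FareyFraction, IsConj w (W x) ∨ IsConj w (W x)⁻¹) ∧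
      -- pairs of primitive associates are the pairs of neighbors
      (∀ x y : FareyFraction,
        ArePrimitiveAssociates (W x) (W y) ↔
          |FareyFraction.num x * FareyFraction.den y
            - FareyFraction.den x * FareyFraction.num y| = 1) := by
  refine ⟨fun x hx => ?_, ?_, fun W hW => ?_⟩
  · obtain ⟨m, r, h⟩ := FareyFraction.exists_areParents hx
    exact ⟨m, r, h.areDistinguishedNeighbors, h.position_lt.1, h.position_lt.2, h.num_eq, h.den_eq⟩
  · exact ⟨_, FareyFraction.isFareyEnumeration_fareyWord (b 0) (b 1),
      fun W hW => hW.eq (FareyFraction.isFareyEnumeration_fareyWord _ _)⟩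
  · exact ⟨hW.isPrimitiveWord, fun w hw => hW.existsUnique_isConj hw,
      hW.arePrimitiveAssociates_iff⟩
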